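/- Let $N\ge 1$ and let $\Omega\subset\mathbb R^N$ be a Lipschitz domain, i.e. a nonempty connected open (possibly unbounded) set which near each of its boundary points coincides, after a rotation of coordinates, with the strict epigraph of a Lipschitz function of $N-1$ variables. Let $\Gamma$ be a nonempty relatively open subset of $\partial\Omega$. For $G:\Omega\to\mathbb R^{(N\times N)\times N}$ and $\zeta:\Omega\to\mathbb R^N$ consider the system $$\nabla\zeta=G\zeta\ \text{ in }\Omega,\qquad \zeta|_\Gamma=0, \tag{$*$}$$ where $G(x)$ is regarded as a linear map from $\mathbb R^N$ to $\mathbb R^{N\times N}$, $\nabla\zeta$ is the weak derivative (Jacobian matrix) of $\zeta$, and $\zeta|_\Gamma=0$ means that the trace of $\zeta$ on $\partial\Omega$ vanishes $\mathcal H^{N-1}$-almost everywhere on $\Gamma$. Here $T$ is the trace of $\zeta$ if there are functions $\varphi_n\in C^\infty(\mathbb R^N;\mathbb R^N)$ such that, for every $R>0$, $\varphi_n\to\zeta$ in $W^{1,1}(\Omega\cap B_R(0);\mathbb R^N)$ and $\varphi_n|_{\partial\Omega}\to T$ in $L^1(\partial\Omega\cap B_R(0),\mathcal H^{N-1};\mathbb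 R^N)$. 1. If $G\in L^1(\Omega;\mathbb R^{(N\times N)\times N})$ and $\zeta\in W^{1,1}(\Omega;\mathbb R^N)$ solves $(*)$, then $\zeta=0$ almost everywhere in $\Omega$. 2. In particular, $L^2$-solutions are unique when $G$ is square-integrable: if $G\in L^2(\Omega;\mathbb R^{(N\times N)\times N})$ and $\zeta\in L^2(\Omega;\mathbb R^N)$ solves $(*)$, then $\zeta=0$ almost everywhere in $\Omega$. -/

import Mathlib

/-!
Along a segment `t ↦ b + t e` the smooth approximations obey the fundamental theorem of calculus,
so if they tend to `0` at the base point `b`, then in the limit `|ζ(b + t e)|` is at most the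
integral over `(0, t]` of `|Dζ(b + s e) e| ≤ |G| |ζ| |e|`, and Grönwall's inequality with an
integrable kernel forces `ζ = 0` on almost every such segment. No slice of `ζ` has to be absolutely
continuous for this: Fubini's theorem and a subsequence of the approximations suffice.

Starting the segments on `Γ`, in a chart that straightens the boundary, gives a nonempty open subset
of `Ω` on which `ζ = 0` almost everywhere. Starting them in a ball on which `ζ` already vanishes
shows that the largest open set on which `ζ = 0` almost everywhere is relatively closed in `Ω`, so
it contains the connected set `Ω`.
-/

open MeasureTheory Filter Topology Set
open scoped ContDiff

/-- A Lipschitz domain in `ℝ^N`: a (possibly unbounded) connected nonempty open set which near each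
of its boundary points is, for some unit vector `v`, the strict epigraph in the direction `v` of a
Lipschitz function on the hyperplane `v^⊥`. -/
structure IsLipschitzDomain {N : ℕ} (Ω : Set (EuclideanSpace ℝ (Fin N))) : Prop where
  isOpen : IsOpen Ω
  isConnected : IsConnected Ω
  exists_epigraph : ∀ x ∈ frontier Ω, ∃ U ∈ 𝓝 x, ∃ v : EuclideanSpace ℝ (Fin N), ‖v‖ = 1 ∧
    ∃ (K : NNReal) (γ : (Submodule.span ℝ {v})ᗮ → ℝ), LipschitzWith K γ ∧
      ∀ y ∈ U, (y ∈ Ω ↔ γ ((Submodule.span ℝ {v})ᗮ.orthogonalProjectionOnto y) < inner ℝ v y)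

/-- `Du` is the weak (distributional) derivative of `u` in the open set `Ω`; the matrix `∇u(x)`
(row-wise gradients) is identified with the linear map `Du x`. -/
structure HasWeakDerivOn {N : ℕ} {F : Type*} [NormedAddCommGroup F] [NormedSpace ℝ F]
    (Ω : Set (EuclideanSpace ℝ (Fin N))) (u : EuclideanSpace ℝ (Fin N) → F)
    (Du : EuclideanSpace ℝ (Fin N) → EuclideanSpace ℝ (Fin N) →L[ℝ] F) : Prop where
  locallyIntegrableOn : LocallyIntegrableOn u Ω
  locallyIntegrableOn_deriv : LocallyIntegrableOn Du Ω
  integral_eq : ∀ φ : EuclideanSpace ℝ (Fin N) → ℝ, ContDiff ℝ ∞ φ → HasCompactSupport φ →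
    tsupport φ ⊆ Ω → ∀ e : EuclideanSpace ℝ (Fin N),
      ∫ x in Ω, (fderiv ℝ φ x e) • u x = - ∫ x in Ω, φ x • Du x e

/-- The Sobolev space `W^{1,1}(Ω; F)`. -/
def MemW11 {N : ℕ} {F : Type*} [NormedAddCommGroup F] [NormedSpace ℝ F]
    (Ω : Set (EuclideanSpace ℝ (Fin N))) (u : EuclideanSpace ℝ (Fin N) → F) : Prop :=
  IntegrableOn u Ω ∧ ∃ Du, HasWeakDerivOn Ω u Du ∧ IntegrableOn Du Ω

/-- `T` is the trace on `∂Ω` of the weakly differentiable function `u`: there are smooth functions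
on `ℝ^N` which converge to `u` in `W^{1,1}(Ω ∩ B_R)` and whose restrictions to the boundary converge
to `T` in `L^1(∂Ω ∩ B_R)` with respect to the surface measure `H^{N-1}`, for every `R`. (For bounded
`Ω` these are convergences in `W^{1,1}(Ω)` and `L^1(∂Ω)`; in general the trace of a function is
only locally integrable on `∂Ω`.) -/
def HasTrace {N : ℕ} {F : Type*} [NormedAddCommGroup F] [NormedSpace ℝ F]
    (Ω : Set (EuclideanSpace ℝ (Fin N))) (u T : EuclideanSpace ℝ (Fin N) → F) : Prop :=
  AEStronglyMeasurable T ((Measure.hausdorffMeasure ((N : ℝ) - 1)).restrict (frontier Ω)) ∧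
  ∃ Du, HasWeakDerivOn Ω u Du ∧
  ∃ f : ℕ → EuclideanSpace ℝ (Fin N) → F, (∀ n, ContDiff ℝ ∞ (f n)) ∧ ∀ R : ℝ,
    Tendsto (fun n => ∫⁻ x in Ω ∩ Metric.ball 0 R, ‖f n x - u x‖ₑ) atTop (𝓝 0) ∧
    Tendsto (fun n => ∫⁻ x in Ω ∩ Metric.ball 0 R, ‖fderiv ℝ (f n) x - Du x‖ₑ) atTop (𝓝 0) ∧
    Tendsto (fun n => ∫⁻ x in frontier Ω ∩ Metric.ball 0 R, ‖f n x - T x‖ₑ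
      ∂(Measure.hausdorffMeasure ((N : ℝ) - 1))) atTop (𝓝 0)

/-- `u|_Γ = 0` in the sense of traces: the trace of `u` vanishes `H^{N-1}`-almost everywhere on the
part `Γ` of the boundary of `Ω`. -/
def TraceVanishesOn {N : ℕ} {F : Type*} [NormedAddCommGroup F] [NormedSpace ℝ F]
    (Ω Γ : Set (EuclideanSpace ℝ (Fin N))) (u : EuclideanSpace ℝ (Fin N) → F) : Prop :=
  ∃ T, HasTrace Ω u T ∧
    ∀ᵐ x ∂((Measure.hausdorffMeasure ((N : ℝ) - 1)).restrict Γ), T x = 0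

open Metric
open scoped ENNReal

section Gronwall

theorem setLIntegral_Ioc_eq_zero_of_lt_one {a b c : ℝ} {D k : ℝ → ℝ≥0∞} (hac : a ≤ c)
    (hD : ∫⁻ t in Ioc a b, D t ≠ ⊤) (hk : ∫⁻ t in Ioc c b, k t < 1)
    (hDk : ∀ᵐ t ∂volume.restrict (Ioc a b), D t ≤ k t * ∫⁻ s in Ioc a t, D s)
    (hc : ∫⁻ t in Ioc a c, D t = 0) : ∫⁻ t in Ioc a b, D t = 0 := by
  have hsub : Ioc c b ⊆ Ioc a b := Ioc_subset_Ioc_left hac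
  set M := ∫⁻ t in Ioc c b, D t
  have hM : M ≠ ⊤ := ne_top_of_le_ne_top hD (lintegral_mono_set hsub)
  have le_M : ∀ t ≤ b, ∫⁻ s in Ioc a t, D s ≤ M := fun t ht =>
    calc ∫⁻ s in Ioc a t, D s ≤ ∫⁻ s in Ioc a c ∪ Ioc c b, D s :=
          lintegral_mono_set ((Ioc_subset_Ioc_right ht).trans Ioc_subset_Ioc_union_Ioc)
      _ ≤ (∫⁻ s in Ioc a c, D s) + M := lintegral_union_le _ _ _
      _ = M := by rw [hc, zero_add]
  have hDM : ∀ᵐ t ∂volume.restrict (Ioc c b), D t ≤ M * k t := by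
    filter_upwards [ae_restrict_of_ae_restrict_of_subset hsub hDk,
      ae_restrict_mem measurableSet_Ioc] with t ht htcb
    rw [mul_comm]
    exact ht.trans (by gcongr; exact le_M t htcb.2)
  have hMk : M ≤ M * ∫⁻ t in Ioc c b, k t :=
    (lintegral_mono_ae hDM).trans_eq (lintegral_const_mul' _ _ hM)
  have hM0 : M = 0 := by
    by_contra hne
    have := (ENNReal.mul_lt_mul_iff_right hne hM).2 hk
    rw [mul_one] at this
    exact this.not_ge hMk
  exact le_antisymm ((le_M b le_rfl).trans hM0.le) zero_le

theorem exists_pos_forall_setLIntegral_Ioc_lt {a T : ℝ} {k : ℝ → ℝ≥0∞}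
    (hk : ∫⁻ t in Ioc a T, k t ≠ ⊤) {ε : ℝ≥0∞} (hε : ε ≠ 0) :
    ∃ d > 0, ∀ b c, a ≤ c → b ≤ T → b - c ≤ d → ∫⁻ t in Ioc c b, k t < ε := by
  obtain ⟨δ, hδ, hkδ⟩ := exists_pos_setLIntegral_lt_of_measure_lt hk hε
  obtain ⟨d, hd, hdδ⟩ := ENNReal.lt_iff_exists_nnreal_btwn.1 hδ
  refine ⟨d, by exact_mod_cast hd, fun b c hac hbT hbc => ?_⟩
  have h := hkδ (Ioc c b) <| calc
    volume.restrict (Ioc a T) (Ioc c b) ≤ volume (Ioc c b) := Measure.restrict_apply_le _ _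
    _ ≤ d := by rw [Real.volume_Ioc, ← ENNReal.ofReal_coe_nnreal]; gcongr
    _ < δ := hdδ
  rwa [Measure.restrict_restrict measurableSet_Ioc,
    inter_eq_left.2 (Ioc_subset_Ioc hac hbT)] at h

theorem setLIntegral_Ioc_eq_zero_of_ae_le_mul {a T : ℝ} {D k : ℝ → ℝ≥0∞}
    (hD : ∫⁻ t in Ioc a T, D t ≠ ⊤) (hk : ∫⁻ t in Ioc a T, k t ≠ ⊤)
    (hDk : ∀ᵐ t ∂volume.restrict (Ioc a T), D t ≤ k t * ∫⁻ s in Ioc a t, D s) :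
    ∫⁻ t in Ioc a T, D t = 0 := by
  obtain ⟨d, hd, hkd⟩ := exists_pos_forall_setLIntegral_Ioc_lt hk one_ne_zero
  have key : ∀ (j : ℕ) (b : ℝ), b ≤ T → b ≤ a + j * d → ∫⁻ t in Ioc a b, D t = 0 := by
    intro j
    induction j with
    | zero => intro b _ hb; simp [Ioc_eq_empty_of_le (show b ≤ a by simpa using hb)]
    | succ j ih =>
      intro b hbT hb
      rcases lt_or_ge b a with hba | hab
      · simp [Ioc_eq_empty_of_le hba.le]
      have hsub : Ioc a b ⊆ Ioc a T := Ioc_subset_Ioc_right hbT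
      push_cast at hb
      refine setLIntegral_Ioc_eq_zero_of_lt_one (c := max a (b - d)) (le_max_left _ _)
        (ne_top_of_le_ne_top hD (lintegral_mono_set hsub))
        (hkd b _ (le_max_left _ _) hbT (by linarith [le_max_right a (b - d)]))
        (ae_restrict_of_ae_restrict_of_subset hsub hDk) (ih _ ?_ ?_)
      · exact max_le (hab.trans hbT) (by linarith)
      · exact max_le (le_add_of_nonneg_right (by positivity)) (by linarith)
  obtain ⟨j, hj⟩ := exists_nat_ge ((T - a) / d)
  exact key j T le_rfl (by linarith [(div_le_iff₀ hd).1 hj])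

end Gronwall

section Lines

theorem exists_strictMono_ae_tendsto_zero_of_tendsto_lintegral {α : Type*} [MeasurableSpace α]
    {μ : Measure α} {f : ℕ → α → ℝ≥0∞} (hf : ∀ n, AEMeasurable (f n) μ)
    (h : Tendsto (fun n => ∫⁻ x, f n x ∂μ) atTop (𝓝 0)) :
    ∃ σ : ℕ → ℕ, StrictMono σ ∧ ∀ᵐ x ∂μ, Tendsto (fun n => f (σ n) x) atTop (𝓝 0) := by
  have hsmall : ∀ j : ℕ, ∃ N, ∀ n ≥ N, ∫⁻ x, f n x ∂μ ≤ 2⁻¹ ^ j := fun j =>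
    eventually_atTop.1 (h.eventually_le_const (ENNReal.pow_pos (by simp) j))
  obtain ⟨σ, hσ, hfσ⟩ := extraction_forall_of_eventually' hsmall
  have hsum : ∫⁻ x, ∑' j, f (σ j) x ∂μ ≠ ⊤ := by
    rw [lintegral_tsum fun j => hf (σ j)]
    exact ne_top_of_le_ne_top (by simp [ENNReal.tsum_geometric]) (ENNReal.tsum_le_tsum hfσ)
  refine ⟨σ, hσ, ?_⟩
  filter_upwards [ae_lt_top' (AEMeasurable.tsum fun j => hf (σ j)) hsum] with x hx
  exact ENNReal.tendsto_atTop_zero_of_tsum_ne_top hx.ne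

variable {F : Type*} [NormedAddCommGroup F]

theorem ae_eq_zero_of_ae_le_mul_of_ae_le_setLIntegral {a T : ℝ} {v w : ℝ → F} {k : ℝ → ℝ}
    (hw : IntegrableOn w (Ioc a T)) (hk : IntegrableOn k (Ioc a T))
    (hwk : ∀ᵐ t ∂volume.restrict (Ioc a T), ‖w t‖ ≤ k t * ‖v t‖)
    (hv : ∀ᵐ t ∂volume.restrict (Ioc a T), ‖v t‖ₑ ≤ ∫⁻ s in Ioc a t, ‖w s‖ₑ) :
    ∀ᵐ t ∂volume.restrict (Ioc a T), v t = 0 := by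
  have hw0 : ∫⁻ t in Ioc a T, ‖w t‖ₑ = 0 := by
    refine setLIntegral_Ioc_eq_zero_of_ae_le_mul hw.2.ne hk.2.ne ?_
    filter_upwards [hwk, hv] with t hwt hvt
    calc ‖w t‖ₑ ≤ ‖k t * ‖v t‖‖ₑ := enorm_le_iff_norm_le.2 (hwt.trans (Real.le_norm_self _))
      _ = ‖k t‖ₑ * ‖v t‖ₑ := by rw [enorm_mul, enorm_norm]
      _ ≤ ‖k t‖ₑ * ∫⁻ s in Ioc a t, ‖w s‖ₑ := by gcongr
  filter_upwards [hv, ae_restrict_mem measurableSet_Ioc] with t hvt ht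
  have h0 : ‖v t‖ₑ ≤ 0 :=
    hvt.trans ((lintegral_mono_set (Ioc_subset_Ioc_right ht.2)).trans_eq hw0)
  simpa using h0

variable [NormedSpace ℝ F]

theorem enorm_le_enorm_add_setLIntegral_deriv {a t : ℝ} {f : ℝ → F} (hf : ContDiff ℝ 1 f)
    (hat : a ≤ t) : ‖f t‖ₑ ≤ ‖f a‖ₑ + ∫⁻ s in Ioc a t, ‖deriv f s‖ₑ := by
  rw [setLIntegral_congr Ioc_ae_eq_Icc]
  calc ‖f t‖ₑ = ‖f a + (f t - f a)‖ₑ := by rw [add_sub_cancel]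
    _ ≤ ‖f a‖ₑ + ‖f t - f a‖ₑ := enorm_add_le _ _
    _ ≤ _ := by gcongr; exact enorm_sub_le_lintegral_deriv_of_contDiffOn_Icc hf.contDiffOn hat

theorem ae_enorm_le_setLIntegral_of_tendsto {a T : ℝ} {f : ℕ → ℝ → F} {v w : ℝ → F}
    (hf : ∀ n, ContDiff ℝ 1 (f n))
    (hvm : AEStronglyMeasurable v (volume.restrict (Ioc a T)))
    (hwm : AEStronglyMeasurable w (volume.restrict (Ioc a T)))
    (ha : Tendsto (fun n => ‖f n a‖ₑ) atTop (𝓝 0))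
    (hv : Tendsto (fun n => ∫⁻ t in Ioc a T, ‖f n t - v t‖ₑ) atTop (𝓝 0))
    (hw : Tendsto (fun n => ∫⁻ t in Ioc a T, ‖deriv (f n) t - w t‖ₑ) atTop (𝓝 0)) :
    ∀ᵐ t ∂volume.restrict (Ioc a T), ‖v t‖ₑ ≤ ∫⁻ s in Ioc a t, ‖w s‖ₑ := by
  obtain ⟨σ, hσ, hvσ⟩ := exists_strictMono_ae_tendsto_zero_of_tendsto_lintegral
    (fun n => ((hf n).continuous.aestronglyMeasurable.sub hvm).enorm) hv
  filter_upwards [hvσ, ae_restrict_mem measurableSet_Ioc] with t hvt ht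
  have hsub : Ioc a t ⊆ Ioc a T := Ioc_subset_Ioc_right ht.2
  have hderiv : ∀ n, ∫⁻ s in Ioc a t, ‖deriv (f n) s‖ₑ ≤
      (∫⁻ s in Ioc a T, ‖deriv (f n) s - w s‖ₑ) + ∫⁻ s in Ioc a t, ‖w s‖ₑ := fun n =>
    calc ∫⁻ s in Ioc a t, ‖deriv (f n) s‖ₑ
        ≤ ∫⁻ s in Ioc a t, (‖deriv (f n) s - w s‖ₑ + ‖w s‖ₑ) :=
          lintegral_mono fun s => by simpa using enorm_add_le (deriv (f n) s - w s) (w s)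
      _ = (∫⁻ s in Ioc a t, ‖deriv (f n) s - w s‖ₑ) + ∫⁻ s in Ioc a t, ‖w s‖ₑ :=
          lintegral_add_right' _ (hwm.mono_measure (Measure.restrict_mono_set _ hsub)).enorm
      _ ≤ _ := by gcongr
  have hbound : ∀ n, ‖v t‖ₑ ≤ ‖f n t - v t‖ₑ + (‖f n a‖ₑ +
      ∫⁻ s in Ioc a T, ‖deriv (f n) s - w s‖ₑ) + ∫⁻ s in Ioc a t, ‖w s‖ₑ := fun n =>
    calc ‖v t‖ₑ ≤ ‖f n t - v t‖ₑ + ‖f n t‖ₑ := by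
          simpa [add_comm] using enorm_sub_le (a := f n t) (b := f n t - v t)
      _ ≤ ‖f n t - v t‖ₑ + (‖f n a‖ₑ + ((∫⁻ s in Ioc a T, ‖deriv (f n) s - w s‖ₑ) +
            ∫⁻ s in Ioc a t, ‖w s‖ₑ)) := by
          gcongr
          exact (enorm_le_enorm_add_setLIntegral_deriv (hf n) ht.1.le).trans
            (by gcongr; exact hderiv n)
      _ = _ := by ring
  refine ge_of_tendsto' (x := atTop) ?_ fun n => hbound (σ n)
  simpa using (hvt.add ((ha.add hw).comp hσ.tendsto_atTop)).add_const (∫⁻ s in Ioc a t, ‖w s‖ₑ)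

end Lines

section Segments

theorem lintegral_comp_le_of_map_le {α β : Type*} [MeasurableSpace α] [MeasurableSpace β]
    {μ : Measure α} {κ : Measure β} {Ψ : α → β} (hΨ : Measurable Ψ) {C : ℝ≥0∞}
    (hmap : μ.map Ψ ≤ C • κ) {h : β → ℝ≥0∞} (hh : AEMeasurable h κ) :
    ∫⁻ x, h (Ψ x) ∂μ ≤ C * ∫⁻ y, h y ∂κ := by
  rw [← lintegral_map' ((hh.smul_measure C).mono_measure hmap) hΨ.aemeasurable,
    ← smul_eq_mul, ← lintegral_smul_measure]
  exact lintegral_mono' hmap le_rfl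

theorem integrable_comp_of_map_le {α β H : Type*} [MeasurableSpace α] [MeasurableSpace β]
    [NormedAddCommGroup H] {μ : Measure α} {κ : Measure β} {Ψ : α → β} (hΨ : Measurable Ψ)
    {C : ℝ≥0∞} (hC : C ≠ ⊤) (hmap : μ.map Ψ ≤ C • κ) {h : β → H} (hh : Integrable h κ) :
    Integrable (fun x => h (Ψ x)) μ :=
  ((hh.smul_measure hC).mono_measure hmap).comp_measurable hΨ

theorem ae_prod_eq_zero_of_ae_ae {P Q F : Type*} [MeasurableSpace P] [MeasurableSpace Q]
    [NormedAddCommGroup F] {μ : Measure P} {ν : Measure Q} [SFinite ν] {h : P × Q → F}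
    (hh : AEStronglyMeasurable h (μ.prod ν)) (h0 : ∀ᵐ p ∂μ, ∀ᵐ t ∂ν, h (p, t) = 0) :
    ∀ᵐ q ∂μ.prod ν, h q = 0 := by
  have hint : ∫⁻ q, ‖h q‖ₑ ∂μ.prod ν = 0 := by
    rw [lintegral_prod _ hh.enorm]
    refine lintegral_eq_zero_of_ae_eq_zero ?_
    filter_upwards [h0] with p hp
    exact lintegral_eq_zero_of_ae_eq_zero (hp.mono fun _ ht => by simp [ht])
  filter_upwards [(lintegral_eq_zero_iff' hh.enorm).1 hint] with q hq
  simpa using hq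

theorem tendsto_zero_of_forall_le {a b : ℕ → ℝ≥0∞} (hb : Tendsto b atTop (𝓝 0))
    (hab : ∀ n, a n ≤ b n) : Tendsto a atTop (𝓝 0) :=
  tendsto_of_tendsto_of_tendsto_of_le_of_le tendsto_const_nhds hb (fun _ => zero_le) hab

variable {E F : Type*} [NormedAddCommGroup E] [NormedSpace ℝ E]
  [NormedAddCommGroup F] [NormedSpace ℝ F]

theorem deriv_comp_add_smul {f : E → F} {x e : E} {t : ℝ}
    (hf : DifferentiableAt ℝ f (x + t • e)) :
    deriv (fun s : ℝ => f (x + s • e)) t = fderiv ℝ f (x + t • e) e := by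
  have hline : HasDerivAt (fun s : ℝ => x + s • e) e t := by
    simpa using ((hasDerivAt_id t).smul_const e).const_add x
  exact (hf.hasFDerivAt.comp_hasDerivAt t hline).deriv

variable [MeasurableSpace E]

/-- The analytic data of the problem `∇u = G u` on a measure space `(E, κ)`: an integrable function
`u` with integrable gradient `Du`, the pointwise bound `|Du| ≤ g |u|` with an integrable `g`, and
a sequence `f` of `C¹` functions converging to `u` in `W^{1,1}(κ)`. -/
structure IsGronwallApprox (κ : Measure E) (u : E → F) (Du : E → E →L[ℝ] F) (g : E → ℝ)
    (f : ℕ → E → F) : Prop where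
  contDiff : ∀ n, ContDiff ℝ 1 (f n)
  integrable : Integrable u κ
  integrable_deriv : Integrable Du κ
  integrable_bound : Integrable g κ
  norm_deriv_le : ∀ᵐ x ∂κ, ‖Du x‖ ≤ g x * ‖u x‖
  tendsto : Tendsto (fun n => ∫⁻ x, ‖f n x - u x‖ₑ ∂κ) atTop (𝓝 0)
  tendsto_deriv : Tendsto (fun n => ∫⁻ x, ‖fderiv ℝ (f n) x - Du x‖ₑ ∂κ) atTop (𝓝 0)

namespace IsGronwallApprox

variable {κ : Measure E} {u : E → F} {Du : E → E →L[ℝ] F} {g : E → ℝ} {f : ℕ → E → F}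

theorem mono_measure (h : IsGronwallApprox κ u Du g f) {κ' : Measure E} (hκ : κ' ≤ κ) :
    IsGronwallApprox κ' u Du g f where
  contDiff := h.contDiff
  integrable := h.integrable.mono_measure hκ
  integrable_deriv := h.integrable_deriv.mono_measure hκ
  integrable_bound := h.integrable_bound.mono_measure hκ
  norm_deriv_le := ae_mono hκ h.norm_deriv_le
  tendsto := tendsto_zero_of_forall_le h.tendsto fun _ => lintegral_mono' hκ le_rfl
  tendsto_deriv := tendsto_zero_of_forall_le h.tendsto_deriv fun _ => lintegral_mono' hκ le_rfl

variable [BorelSpace E] [SecondCountableTopology E]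

theorem aemeasurable_enorm_sub (h : IsGronwallApprox κ u Du g f) (n : ℕ) :
    AEMeasurable (fun x => ‖f n x - u x‖ₑ) κ :=
  ((h.contDiff n).continuous.aestronglyMeasurable.sub h.integrable.1).enorm

theorem aemeasurable_enorm_fderiv_sub (h : IsGronwallApprox κ u Du g f) (n : ℕ) :
    AEMeasurable (fun x => ‖fderiv ℝ (f n) x - Du x‖ₑ) κ :=
  (((h.contDiff n).continuous_fderiv one_ne_zero).aestronglyMeasurable.sub
    h.integrable_deriv.1).enorm

variable {P : Type*} [MeasurableSpace P] {μ : Measure P} {ν : Measure ℝ} [SFinite ν]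

theorem exists_strictMono_ae_tendsto_slice (h : IsGronwallApprox κ u Du g f) {Ψ : P × ℝ → E}
    (hΨ : Measurable Ψ) {C : ℝ≥0∞} (hC : C ≠ ⊤) (hmap : (μ.prod ν).map Ψ ≤ C • κ) {b : P → E}
    (hb : Measurable b) (hfb : Tendsto (fun n => ∫⁻ p, ‖f n (b p)‖ₑ ∂μ) atTop (𝓝 0)) :
    ∃ σ : ℕ → ℕ, ∀ᵐ p ∂μ, Tendsto (fun n => ‖f (σ n) (b p)‖ₑ) atTop (𝓝 0) ∧
      Tendsto (fun n => ∫⁻ t, ‖f (σ n) (Ψ (p, t)) - u (Ψ (p, t))‖ₑ ∂ν) atTop (𝓝 0) ∧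
      Tendsto (fun n => ∫⁻ t, ‖fderiv ℝ (f (σ n)) (Ψ (p, t)) - Du (Ψ (p, t))‖ₑ ∂ν)
        atTop (𝓝 0) := by
  let H n x := ‖f n x - u x‖ₑ + ‖fderiv ℝ (f n) x - Du x‖ₑ
  have hH : ∀ n, AEMeasurable (H n) κ := fun n =>
    (h.aemeasurable_enorm_sub n).add (h.aemeasurable_enorm_fderiv_sub n)
  have hHΨ : ∀ n, AEMeasurable (fun q => H n (Ψ q)) (μ.prod ν) := fun n =>
    (((hH n).smul_measure C).mono_measure hmap).comp_measurable hΨ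
  have hbm : ∀ n, Measurable fun p => ‖f n (b p)‖ₑ := fun n =>
    (h.contDiff n).continuous.enorm.measurable.comp hb
  have hlim : Tendsto (fun n => ∫⁻ p, (‖f n (b p)‖ₑ + ∫⁻ t, H n (Ψ (p, t)) ∂ν) ∂μ)
      atTop (𝓝 0) := by
    have hκ : Tendsto (fun n => ∫⁻ x, H n x ∂κ) atTop (𝓝 0) := by
      simp only [H, lintegral_add_left' (h.aemeasurable_enorm_sub _)]
      simpa using h.tendsto.add h.tendsto_deriv
    refine tendsto_zero_of_forall_le (b := fun n => (∫⁻ p, ‖f n (b p)‖ₑ ∂μ) + C * ∫⁻ x, H n x ∂κ)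
      (by simpa using hfb.add (ENNReal.Tendsto.const_mul hκ (Or.inr hC))) fun n => ?_
    rw [lintegral_add_left (hbm n), ← lintegral_prod _ (hHΨ n)]
    gcongr
    exact lintegral_comp_le_of_map_le hΨ hmap (hH n)
  obtain ⟨σ, -, hσ⟩ := exists_strictMono_ae_tendsto_zero_of_tendsto_lintegral
    (f := fun n p => ‖f n (b p)‖ₑ + ∫⁻ t, H n (Ψ (p, t)) ∂ν)
    (fun n => (hbm n).aemeasurable.add (hHΨ n).lintegral_prod_right') hlim
  refine ⟨σ, hσ.mono fun p hp => ?_⟩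
  have hpH := tendsto_zero_of_forall_le hp fun _ => le_add_self
  exact ⟨tendsto_zero_of_forall_le hp fun _ => le_self_add,
    tendsto_zero_of_forall_le hpH fun _ => lintegral_mono fun _ => le_self_add,
    tendsto_zero_of_forall_le hpH fun _ => lintegral_mono fun _ => le_add_self⟩

theorem ae_eq_zero_of_map_le [SFinite μ] (h : IsGronwallApprox κ u Du g f) {b : P → E}
    (hb : Measurable b) (e : E) {T : ℝ} {C : ℝ≥0∞} (hC : C ≠ ⊤)
    (hmap : (μ.prod (volume.restrict (Ioc 0 T))).map (fun q => b q.1 + q.2 • e) ≤ C • κ)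
    (hfb : Tendsto (fun n => ∫⁻ p, ‖f n (b p)‖ₑ ∂μ) atTop (𝓝 0)) :
    ∀ᵐ q ∂μ.prod (volume.restrict (Ioc 0 T)), u (b q.1 + q.2 • e) = 0 := by
  have hΨ : Measurable fun q : P × ℝ => b q.1 + q.2 • e :=
    (hb.comp measurable_fst).add (measurable_snd.smul_const e)
  have hbound := Measure.ae_ae_of_ae_prod <| ae_of_ae_map hΨ.aemeasurable <|
    ae_mono hmap <| Measure.ae_smul_measure h.norm_deriv_le C
  obtain ⟨σ, hσ⟩ := h.exists_strictMono_ae_tendsto_slice hΨ hC hmap hb hfb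
  refine ae_prod_eq_zero_of_ae_ae (integrable_comp_of_map_le hΨ hC hmap h.integrable).1 ?_
  filter_upwards [(integrable_comp_of_map_le hΨ hC hmap h.integrable).prod_right_ae,
    (integrable_comp_of_map_le hΨ hC hmap h.integrable_deriv).prod_right_ae,
    (integrable_comp_of_map_le hΨ hC hmap h.integrable_bound).prod_right_ae, hbound, hσ]
    with p hu hDu hg hDug ⟨hpb, hpu, hpD⟩
  have hDue : IntegrableOn (fun t : ℝ => Du (b p + t • e) e) (Ioc 0 T) :=
    hDu.apply_continuousLinearMap e
  refine ae_eq_zero_of_ae_le_mul_of_ae_le_setLIntegral hDue (hg.mul_const ‖e‖) ?_ ?_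
  · filter_upwards [hDug] with t ht
    calc ‖Du (b p + t • e) e‖ ≤ ‖Du (b p + t • e)‖ * ‖e‖ := ContinuousLinearMap.le_opNorm _ _
      _ ≤ g (b p + t • e) * ‖u (b p + t • e)‖ * ‖e‖ := by gcongr
      _ = g (b p + t • e) * ‖e‖ * ‖u (b p + t • e)‖ := by ring
  · refine ae_enorm_le_setLIntegral_of_tendsto (f := fun n t => f (σ n) (b p + t • e))
      (fun n => (h.contDiff _).comp (by fun_prop)) hu.1 hDue.1 (by simpa using hpb) hpu ?_
    have hmul := ENNReal.Tendsto.const_mul hpD (Or.inr (enorm_ne_top (x := e)))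
    refine tendsto_zero_of_forall_le (by simpa using hmul) fun n => ?_
    rw [← lintegral_const_mul' _ _ enorm_ne_top]
    refine lintegral_mono fun t => ?_
    rw [deriv_comp_add_smul ((h.contDiff _).differentiable one_ne_zero _), ← sub_apply, mul_comm]
    exact ContinuousLinearMap.le_opENorm _ _

end IsGronwallApprox

end Segments

section UniqueContinuation

/-- The largest open set on which `u` vanishes `μ`-almost everywhere: the complement of the
essential support of `u`. -/
def aeZeroLocus {X F : Type*} [TopologicalSpace X] [MeasurableSpace X] [Zero F] (μ : Measure X)
    (u : X → F) : Set X :=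
  ⋃₀ {W | IsOpen W ∧ ∀ᵐ z ∂μ.restrict W, u z = 0}

section

variable {X F : Type*} [TopologicalSpace X] [MeasurableSpace X] [Zero F] {μ : Measure X} {u : X → F}

theorem isOpen_aeZeroLocus : IsOpen (aeZeroLocus μ u) :=
  isOpen_sUnion fun _ hW => hW.1

theorem subset_aeZeroLocus {W : Set X} (hW : IsOpen W) (hu : ∀ᵐ z ∂μ.restrict W, u z = 0) :
    W ⊆ aeZeroLocus μ u :=
  subset_sUnion_of_mem ⟨hW, hu⟩

theorem ae_restrict_aeZeroLocus [SecondCountableTopology X] :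
    ∀ᵐ z ∂μ.restrict (aeZeroLocus μ u), u z = 0 := by
  obtain ⟨S, hS, hSsub, hSeq⟩ := TopologicalSpace.isOpen_sUnion_countable
    {W | IsOpen W ∧ ∀ᵐ z ∂μ.restrict W, u z = 0} fun _ hW => hW.1
  rw [aeZeroLocus, ← hSeq, sUnion_eq_biUnion, ae_restrict_biUnion_iff _ hS]
  exact fun W hW => (hSsub hW).2

end

variable {E F : Type*} [NormedAddCommGroup E] [NormedSpace ℝ E] [MeasurableSpace E] [BorelSpace E]
  [SecondCountableTopology E] [NormedAddCommGroup F] [NormedSpace ℝ F] {μ : Measure E}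
  [SFinite μ] [μ.IsAddRightInvariant] {u : E → F} {Du : E → E →L[ℝ] F} {g : E → ℝ}
  {f : ℕ → E → F}

theorem map_prod_add_smul_le {A S : Set E} {e : E} (hA : MeasurableSet A)
    (hAS : ∀ z ∈ A, ∀ t ∈ Icc (0 : ℝ) 1, z + t • e ∈ S) :
    ((μ.restrict A).prod (volume.restrict (Ioc (0 : ℝ) 1))).map (fun q => q.1 + q.2 • e) ≤
      μ.restrict S := by
  have hm : Measurable fun q : E × ℝ => q.1 + q.2 • e := by fun_prop
  refine Measure.le_iff.2 fun B hB => ?_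
  rw [Measure.map_apply hm hB, Measure.prod_apply_symm (hm hB), Measure.restrict_apply hB]
  calc ∫⁻ t in Ioc (0 : ℝ) 1, μ.restrict A ((fun z => (z, t)) ⁻¹' ((fun q => q.1 + q.2 • e) ⁻¹' B))
      ≤ ∫⁻ _ in Ioc (0 : ℝ) 1, μ (B ∩ S) := by
        refine setLIntegral_mono measurable_const fun t ht => ?_
        rw [← measure_preimage_add_right μ (t • e) (B ∩ S), Measure.restrict_apply' hA]
        exact measure_mono fun z hz => ⟨hz.1, hAS z hz.2 t ⟨ht.1.le, ht.2⟩⟩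
    _ = μ (B ∩ S) := by simp

namespace IsGronwallApprox

theorem ae_restrict_ae_eq_zero_add_smul {A S : Set E} {e : E}
    (h : IsGronwallApprox (μ.restrict S) u Du g f) (hA : MeasurableSet A)
    (hAS : ∀ z ∈ A, ∀ t ∈ Icc (0 : ℝ) 1, z + t • e ∈ S)
    (hu : ∀ᵐ z ∂μ.restrict A, u z = 0) :
    ∀ᵐ t ∂volume.restrict (Ioc (0 : ℝ) 1), ∀ᵐ z ∂μ.restrict A, u (z + t • e) = 0 := by
  have hAsub : A ⊆ S := fun z hz => by simpa using hAS z hz 0 (by simp)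
  have hfA : Tendsto (fun n => ∫⁻ z in A, ‖f n z‖ₑ ∂μ) atTop (𝓝 0) := by
    refine tendsto_zero_of_forall_le h.tendsto fun n => ?_
    calc ∫⁻ z in A, ‖f n z‖ₑ ∂μ = ∫⁻ z in A, ‖f n z - u z‖ₑ ∂μ :=
          lintegral_congr_ae (hu.mono fun z hz => by simp [hz])
      _ ≤ ∫⁻ z in S, ‖f n z - u z‖ₑ ∂μ := lintegral_mono_set hAsub
  have hprod := h.ae_eq_zero_of_map_le measurable_id e ENNReal.one_ne_top
    (by simpa using map_prod_add_smul_le hA hAS) hfA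
  exact Measure.ae_ae_of_ae_prod
    (Measure.measurePreserving_swap.quasiMeasurePreserving.ae hprod)

theorem mem_aeZeroLocus_of_segment_ball {S : Set E} {x e : E} {δ : ℝ} (hδ : 0 < δ)
    (h : IsGronwallApprox (μ.restrict S) u Du g f)
    (hS : ∀ z ∈ ball x δ, ∀ t ∈ Icc (0 : ℝ) 1, z + t • e ∈ S)
    (hu : ball x δ ⊆ aeZeroLocus μ u) : x + e ∈ aeZeroLocus μ u := by
  have hline := h.ae_restrict_ae_eq_zero_add_smul measurableSet_ball hS
    (ae_restrict_of_ae_restrict_of_subset hu ae_restrict_aeZeroLocus)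
  -- The zero set propagates only for almost every `t`, so we stop at a `t < 1` close enough to `1`
  -- for the translated ball to still contain `x + e`.
  let J := Ioo 0 1 ∩ {t : ℝ | x + e ∈ ball (x + t • e) δ}
  have hJ : IsOpen J := isOpen_Ioo.inter <|
    isOpen_lt (by fun_prop : Continuous fun t : ℝ => dist (x + e) (x + t • e)) continuous_const
  have hJne : J.Nonempty := by
    have h1 : ∀ᶠ t in 𝓝[<] (1 : ℝ), dist (x + e) (x + t • e) < δ := by
      refine Tendsto.eventually_lt_const (v := 0) hδ ?_
      have : Continuous fun t : ℝ => dist (x + e) (x + t • e) := by fun_prop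
      simpa using (this.tendsto 1).mono_left nhdsWithin_le_nhds
    exact (Filter.Eventually.and (Ioo_mem_nhdsLT one_pos) h1).exists
  obtain ⟨t, ⟨-, ht⟩, hut⟩ := Measure.exists_mem_of_measure_ne_zero_of_ae
    (hJ.measure_pos volume hJne).ne' (ae_restrict_of_ae_restrict_of_subset
      (inter_subset_left.trans Ioo_subset_Ioc_self) hline)
  refine subset_aeZeroLocus isOpen_ball ?_ ht
  have hmp := (measurePreserving_sub_right μ (t • e)).restrict_preimage
    (measurableSet_ball (x := x) (ε := δ))
  have hpre : (fun z => z - t • e) ⁻¹' ball x δ = ball (x + t • e) δ := by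
    ext z; simp [dist_eq_norm, sub_sub, add_comm]
  rw [hpre] at hmp
  simpa using hmp.quasiMeasurePreserving.ae hut

end IsGronwallApprox

theorem subset_aeZeroLocus_of_isPreconnected {Ω : Set E} (hconn : IsPreconnected Ω)
    (h : ∀ y ∈ Ω, ∃ V ∈ 𝓝 y, IsGronwallApprox (μ.restrict V) u Du g f)
    (hne : (Ω ∩ aeZeroLocus μ u).Nonempty) : Ω ⊆ aeZeroLocus μ u := by
  refine hconn.subset_of_closure_inter_subset isOpen_aeZeroLocus hne ?_
  rintro y ⟨hyZ, hyΩ⟩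
  obtain ⟨V, hV, hVapprox⟩ := h y hyΩ
  obtain ⟨r, hr, hrV⟩ := Metric.mem_nhds_iff.1 hV
  obtain ⟨x, hxZ, hxy⟩ := mem_closure_iff.1 hyZ (r / 2) (half_pos hr)
  obtain ⟨δ, hδ, hδZ⟩ := isOpen_iff.1 isOpen_aeZeroLocus x hxZ
  have hball : ∀ z ∈ ball x (min δ (r / 2)), ∀ t ∈ Icc (0 : ℝ) 1, z + t • (y - x) ∈ V := by
    intro z hz t ht
    refine hrV ?_
    have hxt : x + t • (y - x) ∈ ball y (r / 2) := (convex_ball y _).add_smul_sub_mem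
      (mem_ball'.2 hxy) (mem_ball_self (half_pos hr)) ht
    calc dist (z + t • (y - x)) y ≤ dist z x + dist (x + t • (y - x)) y := by
          simpa using dist_triangle (z + t • (y - x)) (x + t • (y - x)) y
      _ < r / 2 + r / 2 := add_lt_add (hz.trans_le (min_le_right _ _)) hxt
      _ = r := add_halves r
  simpa using hVapprox.mem_aeZeroLocus_of_segment_ball (lt_min hδ (half_pos hr)) hball
    ((ball_subset_ball (min_le_left _ _)).trans hδZ)

end UniqueContinuation

section Epigraph

theorem frontier_inter_eq_of_inter_eq {X : Type*} [TopologicalSpace X] {s t U : Set X}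
    (hU : IsOpen U) (h : s ∩ U = t ∩ U) : frontier s ∩ U = frontier t ∩ U := by
  rw [← frontier_inter_open_inter hU, h, frontier_inter_open_inter hU]

/-- The homeomorphism `(x, t) ↦ (x, γ x + t)`, which carries the hyperplane `t = 0` to the graph
of `γ`. -/
def graphShear {X : Type*} [TopologicalSpace X] (γ : C(X, ℝ)) : X × ℝ ≃ₜ X × ℝ where
  toEquiv := (Equiv.refl X).prodShear fun x => Equiv.addLeft (γ x)
  continuous_toFun := by
    change Continuous fun q : X × ℝ => (q.1, γ q.1 + q.2)
    fun_prop
  continuous_invFun := by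
    change Continuous fun q : X × ℝ => (q.1, -γ q.1 + q.2)
    fun_prop

theorem measurePreserving_graphShear {X : Type*} [TopologicalSpace X] [MeasurableSpace X]
    [BorelSpace X] (γ : C(X, ℝ)) (m : Measure X) [SFinite m] :
    MeasurePreserving (graphShear γ) (m.prod volume) (m.prod volume) :=
  (MeasurePreserving.id m).skew_product (g := fun x t => γ x + t) (by fun_prop)
    (ae_of_all _ fun x => map_add_left_eq_self volume (γ x))

variable {E : Type*} [NormedAddCommGroup E] [InnerProductSpace ℝ E] {v : E}

theorem orthogonalProjectionOnto_add_smul (y : (Submodule.span ℝ {v})ᗮ) (s : ℝ) :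
    (Submodule.span ℝ {v})ᗮ.orthogonalProjectionOnto (y + s • v) = y := by
  rw [map_add, map_smul, Submodule.orthogonalProjectionOnto_mem_subspace_eq_self,
    Submodule.orthogonalProjectionOnto_orthogonalComplement_singleton_eq_zero, smul_zero, add_zero]

theorem inner_add_smul (hv : ‖v‖ = 1) (y : (Submodule.span ℝ {v})ᗮ) (s : ℝ) :
    inner ℝ v ((y : E) + s • v) = s := by
  rw [inner_add_right, Submodule.mem_orthogonal_singleton_iff_inner_right.1 y.2, inner_smul_right,
    inner_self_eq_one_of_norm_eq_one hv, zero_add, mul_one]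

theorem orthogonalProjectionOnto_add_inner_smul (hv : ‖v‖ = 1) (x : E) :
    ((Submodule.span ℝ {v})ᗮ.orthogonalProjectionOnto x : E) + inner ℝ v x • v = x := by
  have h := Submodule.starProjection_add_starProjection_orthogonal (K := Submodule.span ℝ {v}) x
  rwa [Submodule.starProjection_unit_singleton ℝ hv, add_comm] at h

/-- The linear coordinates `(y, s) ↦ y + s v` on `E` along the hyperplane `v^⊥` and a unit
vector `v`. -/
noncomputable def orthogonalProdEquiv (hv : ‖v‖ = 1) :
    ((Submodule.span ℝ {v})ᗮ × ℝ) ≃L[ℝ] E where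
  toFun q := q.1 + q.2 • v
  map_add' p q := by simp only [Prod.fst_add, Prod.snd_add, Submodule.coe_add, add_smul]; abel
  map_smul' c q := by simp [mul_smul]
  invFun x := ((Submodule.span ℝ {v})ᗮ.orthogonalProjectionOnto x, inner ℝ v x)
  left_inv q := by simp only [orthogonalProjectionOnto_add_smul, inner_add_smul hv]
  right_inv x := orthogonalProjectionOnto_add_inner_smul hv x
  continuous_toFun := by fun_prop
  continuous_invFun := by fun_prop

/-- The chart `(y, t) ↦ y + (γ y + t) v` of `E`, in which the strict epigraph of `γ` in the
direction `v` is the half-space `t > 0`. -/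
noncomputable def graphHomeomorph (hv : ‖v‖ = 1) (γ : C((Submodule.span ℝ {v})ᗮ, ℝ)) :
    (Submodule.span ℝ {v})ᗮ × ℝ ≃ₜ E :=
  (graphShear γ).trans (orthogonalProdEquiv hv).toHomeomorph

section

variable (hv : ‖v‖ = 1) (γ : C((Submodule.span ℝ {v})ᗮ, ℝ))

theorem graphHomeomorph_apply (q : (Submodule.span ℝ {v})ᗮ × ℝ) :
    graphHomeomorph hv γ q = (q.1 : E) + (γ q.1 + q.2) • v :=
  rfl

theorem graphHomeomorph_zero_add_smul (q : (Submodule.span ℝ {v})ᗮ × ℝ) :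
    graphHomeomorph hv γ (q.1, 0) + q.2 • v = graphHomeomorph hv γ q := by
  simp only [graphHomeomorph_apply, add_zero, add_smul, add_assoc]

theorem orthogonalProjectionOnto_graphHomeomorph (q : (Submodule.span ℝ {v})ᗮ × ℝ) :
    (Submodule.span ℝ {v})ᗮ.orthogonalProjectionOnto (graphHomeomorph hv γ q) = q.1 :=
  orthogonalProjectionOnto_add_smul _ _

theorem preimage_graphHomeomorph_epigraph :
    graphHomeomorph hv γ ⁻¹'
      {x | γ ((Submodule.span ℝ {v})ᗮ.orthogonalProjectionOnto x) < inner ℝ v x} =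
      univ ×ˢ Ioi 0 := by
  ext q
  rw [mem_preimage, mem_ofPred_eq, orthogonalProjectionOnto_graphHomeomorph, graphHomeomorph_apply,
    inner_add_smul hv]
  simp

theorem exists_map_graphHomeomorph_eq_smul [FiniteDimensional ℝ E] [MeasurableSpace E]
    [BorelSpace E] (m : Measure (Submodule.span ℝ {v})ᗮ) [m.IsAddHaarMeasure]
    (μ : Measure E) [μ.IsAddHaarMeasure] :
    ∃ c : ℝ≥0∞, c ≠ 0 ∧ c ≠ ⊤ ∧ (m.prod volume).map (graphHomeomorph hv γ) = c • μ := by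
  let L := orthogonalProdEquiv hv
  have : ((m.prod volume).map L).IsAddHaarMeasure := L.isAddHaarMeasure_map _
  refine ⟨((m.prod volume).map L).addHaarScalarFactor μ, ?_, ENNReal.coe_ne_top, ?_⟩
  · exact_mod_cast (Measure.addHaarScalarFactor_pos_of_isAddHaarMeasure _ _).ne'
  · have hcomp : ⇑(graphHomeomorph hv γ) = L ∘ graphShear γ := rfl
    rw [hcomp, ← Measure.map_map L.continuous.measurable (graphShear γ).continuous.measurable,
      (measurePreserving_graphShear γ m).map_eq]
    exact Measure.isAddLeftInvariant_eq_smul _ _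

end

/-- Near `x₀` the set `Ω` is the strict epigraph, in some direction `v`, of a continuous function
on the hyperplane `v^⊥`. -/
def IsEpigraphNear (Ω : Set E) (x₀ : E) : Prop :=
  ∃ U ∈ 𝓝 x₀, ∃ v : E, ‖v‖ = 1 ∧ ∃ γ : C((Submodule.span ℝ {v})ᗮ, ℝ), ∀ y ∈ U,
    (y ∈ Ω ↔ γ ((Submodule.span ℝ {v})ᗮ.orthogonalProjectionOnto y) < inner ℝ v y)

namespace IsEpigraphNear

variable {Ω : Set E} {x₀ : E}

theorem exists_graphHomeomorph (h : IsEpigraphNear Ω x₀) :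
    ∃ U ∈ 𝓝 x₀, ∃ (v : E) (hv : ‖v‖ = 1) (γ : C((Submodule.span ℝ {v})ᗮ, ℝ)),
      ∀ q, graphHomeomorph hv γ q ∈ U → (graphHomeomorph hv γ q ∈ Ω ↔ 0 < q.2) ∧
        (graphHomeomorph hv γ q ∈ frontier Ω ↔ q.2 = 0) := by
  obtain ⟨U, hU, v, hv, γ, hγ⟩ := h
  refine ⟨interior U, interior_mem_nhds.2 hU, v, hv, γ, fun q hq => ?_⟩
  let S := {x | γ ((Submodule.span ℝ {v})ᗮ.orthogonalProjectionOnto x) < inner ℝ v x}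
  have hS : graphHomeomorph hv γ ⁻¹' S = univ ×ˢ Ioi 0 := preimage_graphHomeomorph_epigraph hv γ
  have hΩS : Ω ∩ interior U = S ∩ interior U :=
    ext fun x => and_congr_left fun hx => hγ x (interior_subset hx)
  have hfr := frontier_inter_eq_of_inter_eq isOpen_interior hΩS
  constructor
  · calc graphHomeomorph hv γ q ∈ Ω ↔ q ∈ graphHomeomorph hv γ ⁻¹' S := hγ _ (interior_subset hq)
      _ ↔ 0 < q.2 := by simp [hS]
  · calc graphHomeomorph hv γ q ∈ frontier Ω ↔ graphHomeomorph hv γ q ∈ frontier Ω ∩ interior U :=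
          (and_iff_left hq).symm
      _ ↔ q ∈ graphHomeomorph hv γ ⁻¹' frontier S := by rw [hfr]; exact and_iff_left hq
      _ ↔ q.2 = 0 := by
        rw [Homeomorph.preimage_frontier, hS, frontier_univ_prod_eq, frontier_Ioi]; simp

theorem exists_box (h : IsEpigraphNear Ω x₀) (hx₀ : x₀ ∈ frontier Ω) {V : Set E}
    (hV : V ∈ 𝓝 x₀) :
    ∃ (v : E) (hv : ‖v‖ = 1) (γ : C((Submodule.span ℝ {v})ᗮ, ℝ))
      (A : Set (Submodule.span ℝ {v})ᗮ) (T : ℝ), IsOpen A ∧ A.Nonempty ∧ 0 < T ∧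
      MapsTo (fun y => graphHomeomorph hv γ (y, 0)) A (V ∩ frontier Ω) ∧
      MapsTo (graphHomeomorph hv γ) (A ×ˢ Ioc 0 T) (Ω ∩ V) := by
  obtain ⟨U, hU, v, hv, γ, hγ⟩ := h.exists_graphHomeomorph
  let Ψ := graphHomeomorph hv γ
  obtain ⟨⟨y₀, t₀⟩, rfl⟩ := Ψ.surjective x₀
  obtain rfl : t₀ = 0 := ((hγ _ (mem_of_mem_nhds hU)).2).1 hx₀
  obtain ⟨A, B, hA, hy₀, hB, h0, hAB⟩ := mem_nhds_prod_iff'.1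
    (Ψ.continuous.continuousAt.preimage_mem_nhds (inter_mem hU hV))
  obtain ⟨ε, hε, hεB⟩ := isOpen_iff.1 hB 0 h0
  have hmem : ∀ y ∈ A, ∀ t ∈ Icc 0 (ε / 2), Ψ (y, t) ∈ U ∩ V := fun y hy t ht => by
    refine hAB (mk_mem_prod hy (hεB ?_))
    rw [mem_ball_zero_iff, Real.norm_of_nonneg ht.1]
    linarith [ht.2]
  refine ⟨v, hv, γ, A, ε / 2, hA, ⟨y₀, hy₀⟩, half_pos hε, fun y hy => ?_, ?_⟩
  · have hy0 := hmem y hy 0 ⟨le_rfl, (half_pos hε).le⟩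
    exact ⟨hy0.2, (hγ _ hy0.1).2.2 rfl⟩
  · rintro ⟨y, t⟩ ⟨hy, ht⟩
    have hyt := hmem y hy t ⟨ht.1.le, ht.2⟩
    exact ⟨(hγ _ hyt.1).1.2 ht.1, hyt.2⟩

end IsEpigraphNear

theorem IsLipschitzDomain.isEpigraphNear {N : ℕ} {Ω : Set (EuclideanSpace ℝ (Fin N))}
    (hΩ : IsLipschitzDomain Ω) {x₀ : EuclideanSpace ℝ (Fin N)} (hx₀ : x₀ ∈ frontier Ω) :
    IsEpigraphNear Ω x₀ := by
  obtain ⟨U, hU, v, hv, K, γ, hγ, hΩγ⟩ := hΩ.exists_epigraph x₀ hx₀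
  exact ⟨U, hU, v, hv, ⟨γ, hγ.continuous⟩, hΩγ⟩

end Epigraph

section Boundary

theorem map_restrict_le_restrict_map {α β : Type*} [MeasurableSpace α] [MeasurableSpace β]
    {μ : Measure α} {Ψ : α → β} (hΨ : Measurable Ψ) {s : Set α} {t : Set β}
    (ht : MeasurableSet t) (hst : MapsTo Ψ s t) :
    (μ.restrict s).map Ψ ≤ (μ.map Ψ).restrict t := by
  rw [Measure.restrict_map hΨ ht]
  exact Measure.map_mono (Measure.restrict_mono_set _ hst) hΨ

theorem ae_restrict_image_of_map_eq_smul {α β : Type*} [MeasurableSpace α] [MeasurableSpace β]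
    {μ : Measure α} {κ : Measure β} {Ψ : α → β} (hΨ : MeasurableEmbedding Ψ) {c : ℝ≥0∞}
    (hc : c ≠ 0) (hmap : μ.map Ψ = c • κ) {s : Set α} {p : β → Prop}
    (h : ∀ᵐ x ∂μ.restrict s, p (Ψ x)) : ∀ᵐ y ∂κ.restrict (Ψ '' s), p y := by
  rwa [← Measure.ae_ennreal_smul_measure_iff hc, ← Measure.restrict_smul, ← hmap,
    hΨ.restrict_map, preimage_image_eq _ hΨ.injective, hΨ.ae_map_iff]

theorem setLIntegral_comp_hausdorffMeasure_le {X Y : Type*} [EMetricSpace X] [MeasurableSpace X]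
    [BorelSpace X] [EMetricSpace Y] [MeasurableSpace Y] [BorelSpace Y] {b : X → Y} {P : Y → X}
    (hP : LipschitzWith 1 P) (hPb : Function.LeftInverse P b) (hb : Measurable b) {A : Set X}
    {S : Set Y} (hAS : MapsTo b A S) {d : ℝ} (hd : 0 ≤ d) {f : Y → ℝ≥0∞} (hf : Measurable f) :
    ∫⁻ x in A, f (b x) ∂Measure.hausdorffMeasure d ≤
      ∫⁻ y in S, f y ∂Measure.hausdorffMeasure d := by
  rw [← lintegral_map hf hb]
  refine lintegral_mono' (Measure.le_iff.2 fun B hB => ?_) le_rfl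
  rw [Measure.map_apply hb hB, Measure.restrict_apply (hb hB), Measure.restrict_apply hB]
  calc Measure.hausdorffMeasure d (b ⁻¹' B ∩ A) ≤ Measure.hausdorffMeasure d (P '' (B ∩ S)) :=
        measure_mono fun x hx => ⟨b x, ⟨hx.1, hAS hx.2⟩, hPb x⟩
    _ ≤ Measure.hausdorffMeasure d (B ∩ S) := by
        simpa using hP.hausdorffMeasure_image_le hd (B ∩ S)

theorem finrank_orthogonal_span_singleton_eq_sub_one {E : Type*} [NormedAddCommGroup E]
    [InnerProductSpace ℝ E] [FiniteDimensional ℝ E] {v : E} (hv : v ≠ 0) :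
    (Module.finrank ℝ (Submodule.span ℝ {v})ᗮ : ℝ) = Module.finrank ℝ E - 1 := by
  rw [← Submodule.finrank_add_finrank_orthogonal (Submodule.span ℝ {v}), finrank_span_singleton hv]
  push_cast
  ring

namespace IsGronwallApprox

variable {E F : Type*} [NormedAddCommGroup E] [InnerProductSpace ℝ E] [FiniteDimensional ℝ E]
  [MeasurableSpace E] [BorelSpace E] [NormedAddCommGroup F] [NormedSpace ℝ F] {μ : Measure E}
  [μ.IsAddHaarMeasure] {u : E → F} {Du : E → E →L[ℝ] F} {g : E → ℝ} {f : ℕ → E → F}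

theorem ae_restrict_image_graphHomeomorph_eq_zero {S B : Set E}
    (h : IsGronwallApprox (μ.restrict S) u Du g f) (hS : MeasurableSet S) {v : E} (hv : ‖v‖ = 1)
    (γ : C((Submodule.span ℝ {v})ᗮ, ℝ)) {A : Set (Submodule.span ℝ {v})ᗮ} {T : ℝ}
    (hAS : MapsTo (graphHomeomorph hv γ) (A ×ˢ Ioc 0 T) S)
    (hAB : MapsTo (fun y => graphHomeomorph hv γ (y, 0)) A B)
    (hf : Tendsto (fun n => ∫⁻ x in B, ‖f n x‖ₑ
      ∂Measure.hausdorffMeasure ((Module.finrank ℝ E : ℝ) - 1)) atTop (𝓝 0)) :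
    ∀ᵐ z ∂μ.restrict (graphHomeomorph hv γ '' (A ×ˢ Ioc 0 T)), u z = 0 := by
  let Q := (Submodule.span ℝ {v})ᗮ
  let m : Measure Q := Measure.hausdorffMeasure (Module.finrank ℝ Q)
  let Ψ := graphHomeomorph hv γ
  have hb : Continuous fun y => Ψ (y, 0) := by fun_prop
  obtain ⟨c, hc0, hc, hmap⟩ := exists_map_graphHomeomorph_eq_smul hv γ m μ
  have hbox : ((m.restrict A).prod (volume.restrict (Ioc 0 T))).map
      (fun q => Ψ (q.1, 0) + q.2 • v) ≤ c • μ.restrict S := by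
    simp only [Ψ, graphHomeomorph_zero_add_smul]
    rw [Measure.prod_restrict, ← Measure.restrict_smul, ← hmap]
    exact map_restrict_le_restrict_map Ψ.continuous.measurable hS hAS
  have hv0 : v ≠ 0 := norm_ne_zero_iff.1 (by simp [hv])
  have hbase : Tendsto (fun n => ∫⁻ y in A, ‖f n (Ψ (y, 0))‖ₑ ∂m) atTop (𝓝 0) := by
    rw [← finrank_orthogonal_span_singleton_eq_sub_one hv0] at hf
    exact tendsto_zero_of_forall_le hf fun n => setLIntegral_comp_hausdorffMeasure_le
      (Submodule.lipschitzWith_orthogonalProjectionOnto Q)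
      (fun y => orthogonalProjectionOnto_graphHomeomorph hv γ (y, 0)) hb.measurable hAB
      (Nat.cast_nonneg _) (h.contDiff n).continuous.enorm.measurable
  have hzero := h.ae_eq_zero_of_map_le hb.measurable v hc hbox hbase
  simp only [Ψ, graphHomeomorph_zero_add_smul, Measure.prod_restrict] at hzero
  exact ae_restrict_image_of_map_eq_smul (p := fun x => u x = 0) Ψ.measurableEmbedding hc0 hmap
    hzero

theorem inter_aeZeroLocus_nonempty_of_isEpigraphNear {Ω V : Set E} {x₀ : E}
    (h : IsGronwallApprox (μ.restrict (Ω ∩ V)) u Du g f) (hΩ : IsOpen Ω) (hV : IsOpen V)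
    (hx₀ : x₀ ∈ V ∩ frontier Ω) (hepi : IsEpigraphNear Ω x₀)
    (hf : Tendsto (fun n => ∫⁻ x in V ∩ frontier Ω, ‖f n x‖ₑ
      ∂Measure.hausdorffMeasure ((Module.finrank ℝ E : ℝ) - 1)) atTop (𝓝 0)) :
    (Ω ∩ aeZeroLocus μ u).Nonempty := by
  obtain ⟨v, hv, γ, A, T, hA, ⟨y₀, hy₀⟩, hT, hA0, hAT⟩ := hepi.exists_box hx₀.2
    (hV.mem_nhds hx₀.1)
  let Ψ := graphHomeomorph hv γ
  have hzero := h.ae_restrict_image_graphHomeomorph_eq_zero (hΩ.inter hV).measurableSet hv γ hAT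
    hA0 hf
  have hsub : A ×ˢ Ioo 0 T ⊆ A ×ˢ Ioc 0 T := prod_mono_right Ioo_subset_Ioc_self
  have hmem : (y₀, T / 2) ∈ A ×ˢ Ioo 0 T := ⟨hy₀, half_pos hT, half_lt_self hT⟩
  exact ⟨Ψ (y₀, T / 2), (hAT (hsub hmem)).1,
    subset_aeZeroLocus (Ψ.isOpenMap _ (hA.prod isOpen_Ioo))
      (ae_restrict_of_ae_restrict_of_subset (image_mono hsub) hzero) (mem_image_of_mem Ψ hmem)⟩

end IsGronwallApprox

end Boundary

section WeakDeriv

theorem integrable_of_tendsto_lintegral_enorm_sub {α H : Type*} [MeasurableSpace α]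
    [NormedAddCommGroup H] {μ : Measure α} {f : ℕ → α → H} {h : α → H}
    (hf : ∀ n, Integrable (f n) μ) (hh : AEStronglyMeasurable h μ)
    (hlim : Tendsto (fun n => ∫⁻ x, ‖f n x - h x‖ₑ ∂μ) atTop (𝓝 0)) : Integrable h μ := by
  obtain ⟨n, hn⟩ := (hlim.eventually_lt_const ENNReal.zero_lt_top).exists
  have hsub : Integrable (f n - h) μ := ⟨(hf n).1.sub hh, hn⟩
  simpa using (hf n).sub hsub

theorem integrableOn_inter_ball_of_memLp {E H : Type*} [NormedAddCommGroup E] [ProperSpace E]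
    [MeasurableSpace E] [NormedAddCommGroup H] {μ : Measure E} [IsFiniteMeasureOnCompacts μ]
    {p : ℝ≥0∞} (hp : 1 ≤ p) {Ω : Set E} {g : E → H} (hg : MemLp g p (μ.restrict Ω)) (R : ℝ) :
    IntegrableOn g (Ω ∩ ball 0 R) μ := by
  have : IsFiniteMeasure (μ.restrict (Ω ∩ ball 0 R)) := isFiniteMeasure_restrict.2
    (measure_ne_top_of_subset inter_subset_right measure_ball_lt_top.ne)
  exact (hg.mono_measure (Measure.restrict_mono_set _ inter_subset_left)).integrable hp

variable {E H : Type*} [NormedAddCommGroup E] [MeasurableSpace E] [BorelSpace E] {μ : Measure E}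
  [NormedAddCommGroup H] {Ω : Set E}

theorem integrableOn_of_continuous_of_isBounded [ProperSpace E] [IsFiniteMeasureOnCompacts μ]
    {f : E → H} (hf : Continuous f) (hΩ : Bornology.IsBounded Ω) : IntegrableOn f Ω μ :=
  (hf.continuousOn.integrableOn_compact hΩ.isCompact_closure).mono_set subset_closure

theorem integrable_smul_of_locallyIntegrableOn [NormedSpace ℝ H] {h : E → H}
    (hh : LocallyIntegrableOn h Ω μ) {φ : E → ℝ} (hφ : Continuous φ) (hc : HasCompactSupport φ)
    (hs : tsupport φ ⊆ Ω) : Integrable (fun x => φ x • h x) μ :=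
  (integrableOn_iff_integrable_of_support_subset
    ((Function.support_smul_subset_left _ _).trans (subset_tsupport _))).1
    ((hh.integrableOn_compact_subset hs hc).continuousOn_smul hφ.continuousOn hc)

theorem IsGronwallApprox.of_isBounded [NormedSpace ℝ E] [FiniteDimensional ℝ E]
    [NormedSpace ℝ H] [IsFiniteMeasureOnCompacts μ] {u : E → H} {Du : E → E →L[ℝ] H} {g : E → ℝ}
    {f : ℕ → E → H} (hΩ : Bornology.IsBounded Ω) (hf : ∀ n, ContDiff ℝ 1 (f n))
    (hu : AEStronglyMeasurable u (μ.restrict Ω)) (hDu : AEStronglyMeasurable Du (μ.restrict Ω))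
    (hg : IntegrableOn g Ω μ) (hDug : ∀ᵐ x ∂μ.restrict Ω, ‖Du x‖ ≤ g x * ‖u x‖)
    (hlim : Tendsto (fun n => ∫⁻ x in Ω, ‖f n x - u x‖ₑ ∂μ) atTop (𝓝 0))
    (hlim' : Tendsto (fun n => ∫⁻ x in Ω, ‖fderiv ℝ (f n) x - Du x‖ₑ ∂μ) atTop (𝓝 0)) :
    IsGronwallApprox (μ.restrict Ω) u Du g f where
  contDiff := hf
  integrable := integrable_of_tendsto_lintegral_enorm_sub
    (fun n => integrableOn_of_continuous_of_isBounded (hf n).continuous hΩ) hu hlim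
  integrable_deriv := integrable_of_tendsto_lintegral_enorm_sub
    (fun n => integrableOn_of_continuous_of_isBounded
      ((hf n).continuous_fderiv one_ne_zero) hΩ) hDu hlim'
  integrable_bound := hg
  norm_deriv_le := hDug
  tendsto := hlim
  tendsto_deriv := hlim'

theorem HasWeakDerivOn.ae_eq {N : ℕ} {F : Type*} [NormedAddCommGroup F] [NormedSpace ℝ F]
    [CompleteSpace F] {Ω : Set (EuclideanSpace ℝ (Fin N))} {u : EuclideanSpace ℝ (Fin N) → F}
    {D₁ D₂ : EuclideanSpace ℝ (Fin N) → EuclideanSpace ℝ (Fin N) →L[ℝ] F}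
    (h₁ : HasWeakDerivOn Ω u D₁) (h₂ : HasWeakDerivOn Ω u D₂) (hΩ : IsOpen Ω) :
    D₁ =ᵐ[volume.restrict Ω] D₂ := by
  have hzero := hΩ.ae_eq_zero_of_integral_contDiff_smul_eq_zero (μ := volume)
    (h₁.locallyIntegrableOn_deriv.sub h₂.locallyIntegrableOn_deriv) fun φ hφ hc hs => ?_
  · rw [EventuallyEq, ae_restrict_iff' hΩ.measurableSet]
    filter_upwards [hzero] with x hx hxΩ using sub_eq_zero.1 (hx hxΩ)
  have hint₁ := integrable_smul_of_locallyIntegrableOn h₁.locallyIntegrableOn_deriv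
    hφ.continuous hc hs
  have hint₂ := integrable_smul_of_locallyIntegrableOn h₂.locallyIntegrableOn_deriv
    hφ.continuous hc hs
  have hoff : ∀ (D : EuclideanSpace ℝ (Fin N) → EuclideanSpace ℝ (Fin N) →L[ℝ] F), ∀ x ∉ Ω,
      φ x • D x = 0 := fun D x hx => by
    rw [image_eq_zero_of_notMem_tsupport fun hx' => hx (hs hx'), zero_smul]
  simp only [Pi.sub_apply, smul_sub]
  rw [integral_sub hint₁ hint₂, sub_eq_zero,
    ← setIntegral_eq_integral_of_forall_compl_eq_zero (hoff D₁),
    ← setIntegral_eq_integral_of_forall_compl_eq_zero (hoff D₂)]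
  ext e : 1
  rw [ContinuousLinearMap.integral_apply hint₁.integrableOn,
    ContinuousLinearMap.integral_apply hint₂.integrableOn]
  exact neg_injective ((h₁.integral_eq φ hφ hc hs e).symm.trans (h₂.integral_eq φ hφ hc hs e))

end WeakDeriv

theorem theorem1_general {N : ℕ} {F : Type*} [NormedAddCommGroup F] [NormedSpace ℝ F]
    [CompleteSpace F] {Ω Γ : Set (EuclideanSpace ℝ (Fin N))} (hΩ : IsOpen Ω)
    (hconn : IsPreconnected Ω)
    (hΓ : ∃ V : Set (EuclideanSpace ℝ (Fin N)), IsOpen V ∧ Γ = V ∩ frontier Ω)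
    (hepi : ∃ x₀ ∈ Γ, IsEpigraphNear Ω x₀) {g : EuclideanSpace ℝ (Fin N) → ℝ}
    (hg : ∀ R, IntegrableOn g (Ω ∩ ball 0 R)) {ζ : EuclideanSpace ℝ (Fin N) → F}
    {Dζ : EuclideanSpace ℝ (Fin N) → EuclideanSpace ℝ (Fin N) →L[ℝ] F}
    (hζ : HasWeakDerivOn Ω ζ Dζ) (hDζ : ∀ᵐ x ∂volume.restrict Ω, ‖Dζ x‖ ≤ g x * ‖ζ x‖)
    (htr : TraceVanishesOn Ω Γ ζ) : ∀ᵐ x ∂volume.restrict Ω, ζ x = 0 := by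
  obtain ⟨V, hV, rfl⟩ := hΓ
  obtain ⟨x₀, ⟨hx₀V, hx₀⟩, hx₀epi⟩ := hepi
  obtain ⟨T, ⟨-, Du, hDu, f, hf, hlim⟩, hT⟩ := htr
  have hDug : ∀ᵐ x ∂volume.restrict Ω, ‖Du x‖ ≤ g x * ‖ζ x‖ := by
    filter_upwards [hDu.ae_eq hζ hΩ, hDζ] with x hx hxg using hx ▸ hxg
  have happrox : ∀ R, IsGronwallApprox (volume.restrict (Ω ∩ ball 0 R)) ζ Du g f := fun R =>
    .of_isBounded (isBounded_ball.subset inter_subset_right) (fun n => (hf n).of_le (by simp))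
      (hDu.locallyIntegrableOn.aestronglyMeasurable.mono_set inter_subset_left)
      (hDu.locallyIntegrableOn_deriv.aestronglyMeasurable.mono_set inter_subset_left) (hg R)
      (ae_restrict_of_ae_restrict_of_subset inter_subset_left hDug) (hlim R).1 (hlim R).2.1
  let W := V ∩ ball (0 : EuclideanSpace ℝ (Fin N)) (‖x₀‖ + 1)
  have hx₀W : x₀ ∈ W := ⟨hx₀V, by simp⟩
  have hbdry : Tendsto (fun n => ∫⁻ x in W ∩ frontier Ω, ‖f n x‖ₑ
      ∂Measure.hausdorffMeasure ((N : ℝ) - 1)) atTop (𝓝 0) := by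
    refine tendsto_zero_of_forall_le (hlim (‖x₀‖ + 1)).2.2 fun n => ?_
    calc _ = ∫⁻ x in W ∩ frontier Ω, ‖f n x - T x‖ₑ ∂Measure.hausdorffMeasure ((N : ℝ) - 1) := by
          refine lintegral_congr_ae ?_
          filter_upwards [ae_restrict_of_ae_restrict_of_subset
            (inter_subset_inter_left _ inter_subset_left) hT] with x hx
          rw [hx, sub_zero]
      _ ≤ ∫⁻ x in frontier Ω ∩ ball 0 (‖x₀‖ + 1), ‖f n x - T x‖ₑ
            ∂Measure.hausdorffMeasure ((N : ℝ) - 1) :=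
          lintegral_mono_set fun x hx => ⟨hx.2, hx.1.2⟩
  have hne : (Ω ∩ aeZeroLocus volume ζ).Nonempty :=
    ((happrox (‖x₀‖ + 1)).mono_measure (Measure.restrict_mono_set _
      (inter_subset_inter_right _ inter_subset_right))).inter_aeZeroLocus_nonempty_of_isEpigraphNear
        hΩ (hV.inter isOpen_ball) ⟨hx₀W, hx₀⟩ hx₀epi (by rwa [finrank_euclideanSpace_fin])
  have hsub : Ω ⊆ aeZeroLocus volume ζ := subset_aeZeroLocus_of_isPreconnected hconn
    (fun y hy => ⟨Ω ∩ ball 0 (‖y‖ + 1),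
      (hΩ.inter isOpen_ball).mem_nhds ⟨hy, by simp⟩, happrox _⟩) hne
  exact ae_restrict_of_ae_restrict_of_subset hsub ae_restrict_aeZeroLocus

theorem theorem1 {N : ℕ} (Ω Γ : Set (EuclideanSpace ℝ (Fin N))) (hΩ : IsLipschitzDomain Ω)
    (hΓ : ∃ V : Set (EuclideanSpace ℝ (Fin N)), IsOpen V ∧ Γ = V ∩ frontier Ω)
    (hΓne : Γ.Nonempty)
    (G : EuclideanSpace ℝ (Fin N) →
      EuclideanSpace ℝ (Fin N) →L[ℝ] (EuclideanSpace ℝ (Fin N) →L[ℝ] EuclideanSpace ℝ (Fin N))) :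
    (MemLp G 1 (volume.restrict Ω) → ∀ ζ : EuclideanSpace ℝ (Fin N) → EuclideanSpace ℝ (Fin N),
      MemW11 Ω ζ → HasWeakDerivOn Ω ζ (fun x => G x (ζ x)) → TraceVanishesOn Ω Γ ζ →
        ∀ᵐ x ∂(volume.restrict Ω), ζ x = 0) ∧
    (MemLp G 2 (volume.restrict Ω) →
      ∀ ζ : EuclideanSpace ℝ (Fin N) → EuclideanSpace ℝ (Fin N),
      MemLp ζ 2 (volume.restrict Ω) → HasWeakDerivOn Ω ζ (fun x => G x (ζ x)) →
      TraceVanishesOn Ω Γ ζ →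
        ∀ᵐ x ∂(volume.restrict Ω), ζ x = 0) := by
  have hepi : ∃ x₀ ∈ Γ, IsEpigraphNear Ω x₀ := by
    obtain ⟨V, -, rfl⟩ := hΓ
    exact hΓne.imp fun x₀ hx₀ => ⟨hx₀, hΩ.isEpigraphNear hx₀.2⟩
  have huniq : ∀ p : ℝ≥0∞, 1 ≤ p → MemLp G p (volume.restrict Ω) →
      ∀ ζ : EuclideanSpace ℝ (Fin N) → EuclideanSpace ℝ (Fin N),
      HasWeakDerivOn Ω ζ (fun x => G x (ζ x)) → TraceVanishesOn Ω Γ ζ →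
        ∀ᵐ x ∂(volume.restrict Ω), ζ x = 0 := fun p hp hG ζ hζ => by
    let E := EuclideanSpace ℝ (Fin N)
    have hGnorm := MemLp.norm (E := E →L[ℝ] (E →L[ℝ] E)) hG
    exact theorem1_general hΩ.isOpen hΩ.isConnected.isPreconnected hΓ hepi
      (integrableOn_inter_ball_of_memLp hp hGnorm) hζ (ae_of_all _ fun x => (G x).le_opNorm _)
  exact ⟨fun hG ζ _ => huniq 1 le_rfl hG ζ, fun hG ζ _ => huniq 2 one_le_two hG ζ⟩
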